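/- Let $(X_i)_{i\ge 1}$ be i.i.d. real random variables with $X_i\ge 0$ almost surely, $m:=\mathbb{E}[X_1]>0$, and $\mathbb{E}[e^{t_0X_1}]<\infty$ for some $t_0>0$. Let $k\ge 1$ be an integer, let $\phi^{(k)}(y_1,\dots,y_k)=y_1\cdots y_k$ be the product kernel of order $k$, and for $n\ge k$ let $$U_n(\phi^{(k)})=\binom nk^{-1}\sum_{1\le i_1<\dots<i_k\le n}X_{i_1}\cdots X_{i_k}$$ be the corresponding U-statistic. Let $(b_n)_{n\ge1}$ be positive reals with $b_n\to\infty$ and $b_n/\sqrt n\to0$. Then the sequences $$\Bigl(\tfrac{\sqrt n}{b_n}\bigl(U_n(\phi^{(k)})-m^k\bigr)\Bigr)_{n\ge k}\quad\text{and}\quad\Bigl(\tfrac{\sqrt n}{b_n}\,k\,m^{k-1}\,\tfrac1n\sum_{i=1}^n(X_i-m)\Bigr)_{n\ge k}$$ are exponentially equivalent at speed $b_n^2$; that is, writing $\xi_n,\eta_n$ for their $n$-th terms, for every $\varepsilon>0$ $$\lim_{n\to\infty}\frac1{b_n^2}\log\mathbb{P}\bigl[|\xi_n-\eta_n|>\varepsilon\bigr]=-\infty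 .$$ If moreover $\operatorname{Var}[X_1]>0$, then $(\xi_n)_{n\ge k}$ satisfies a moderate deviations principle in $\mathbb{R}$ at speed $b_n^2$ with good rate function $$I(x)=\frac{x^2}{2\sigma^2},\qquad \sigma^2=m^{2(k-1)}k^2\operatorname{Var}[X_1];$$ that is, $I$ has compact sublevel sets and for every Borel set $A\subseteq\mathbb{R}$, with interior $A^\circ$ and closure $\overline A$ (and $\inf\emptyset=+\infty$, $\log 0=-\infty$), $$-\inf_{x\in A^\circ}I(x)\le\liminf_{n\to\infty}\frac1{b_n^2}\log\mathbb{P}[\xi_n\in A]\le\limsup_{n\to\infty}\frac1{b_n^2}\log\mathbb{P}[\xi_n\in A]\le-\inf_{x\in\overline A}I(x).$$ -/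

import Mathlib

open MeasureTheory ProbabilityTheory Filter Topology
open scoped ENNReal

namespace UStatMDP

/-- A kernel of order `k`: a symmetric measurable function `ℝᵏ → ℝ`. -/
structure SymKernel (k : ℕ) where
  toFun : (Fin k → ℝ) → ℝ
  measurable' : Measurable toFun
  symm' : ∀ (σ : Equiv.Perm (Fin k)) (y : Fin k → ℝ), toFun (y ∘ σ) = toFun y

/-- The product kernel `(y₁, …, y_k) ↦ y₁ ⋯ y_k` of order `k`. -/
def prodKernel (k : ℕ) : SymKernel k where
  toFun y := ∏ j, y j
  measurable' := by fun_prop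
  symm' σ y := Equiv.prod_comp σ y

/-- The index set `J` of all strictly increasing `k`-tuples with entries in an `n`-element chain. -/
noncomputable def incTuples (k n : ℕ) : Finset (Fin k → Fin n) :=
  open Classical in Finset.univ.filter fun i => StrictMono i

/-- The U-statistic `(n choose k)⁻¹ ∑_{i₁ < ⋯ < i_k} φ (x_{i₁}, …, x_{i_k})`
(only used for `k ≤ n`). -/
noncomputable def uStat {k : ℕ} (φ : SymKernel k) (n : ℕ) (x : Fin n → ℝ) : ℝ :=
  (n.choose k : ℝ)⁻¹ * ∑ i ∈ incTuples k n, φ.toFun fun j => x (i j)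

/-- Good rate function: not identically `∞`, with compact sublevel sets. -/
structure IsGoodRateFunction {E : Type*} [TopologicalSpace E] (I : E → ℝ≥0∞) : Prop where
  exists_ne_top : ∃ x, I x ≠ ∞
  isCompact_sublevel : ∀ a : ℝ≥0∞, a ≠ ∞ → IsCompact {x | I x ≤ a}

/-- `(ξ n)` satisfies a large deviations principle at speed `s` with good rate function `I`.
Here `ENNReal.log 0 = -∞`, and the infimum over the empty set is `+∞`. -/
structure SatisfiesLDP {Ω : Type*} [MeasurableSpace Ω] (μ : Measure Ω)
    {E : Type*} [TopologicalSpace E] [MeasurableSpace E]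
    (ξ : ℕ → Ω → E) (s : ℕ → ℝ) (I : E → ℝ≥0∞) : Prop where
  tendsto_speed : Tendsto s atTop atTop
  isGoodRateFunction : IsGoodRateFunction I
  lower : ∀ A : Set E, MeasurableSet A →
    -(⨅ x ∈ interior A, (I x : EReal)) ≤
      liminf (fun n => ENNReal.log (μ {ω | ξ n ω ∈ A}) / ((s n : ℝ) : EReal)) atTop
  upper : ∀ A : Set E, MeasurableSet A →
    limsup (fun n => ENNReal.log (μ {ω | ξ n ω ∈ A}) / ((s n : ℝ) : EReal)) atTop ≤
      -(⨅ x ∈ closure A, (I x : EReal))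

/-- The (already normalized) sequence `(ξ n)` satisfies a moderate deviations principle at speed
`b n ^ 2` with good rate function `I`: the sequence `b` is in the moderate deviations range
`1 ≪ b n ≪ √n`, and `(ξ n)` satisfies a large deviations principle at speed `b n ^ 2`. -/
structure SatisfiesMDP {Ω : Type*} [MeasurableSpace Ω] (μ : Measure Ω)
    {E : Type*} [TopologicalSpace E] [MeasurableSpace E]
    (ξ : ℕ → Ω → E) (b : ℕ → ℝ) (I : E → ℝ≥0∞) : Prop where
  pos : ∀ n, 0 < b n
  tendsto_atTop : Tendsto b atTop atTop
  tendsto_div_sqrt : Tendsto (fun n : ℕ => b n / √(n : ℝ)) atTop (𝓝 0)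
  ldp : SatisfiesLDP μ ξ (fun n => b n ^ 2) I

/-- Exponential equivalence of `(ξ n)` and `(η n)` at speed `s`. -/
def ExpEquivalent {Ω : Type*} [MeasurableSpace Ω] (μ : Measure Ω)
    {E : Type*} [NormedAddCommGroup E]
    (ξ η : ℕ → Ω → E) (s : ℕ → ℝ) : Prop :=
  ∀ ε : ℝ, 0 < ε →
    Tendsto (fun n => ENNReal.log (μ {ω | ε < ‖ξ n ω - η n ω‖}) / ((s n : ℝ) : EReal))
      atTop (𝓝 ⊥)

end UStatMDP

/-! For the product kernel, `uStat` is a normalized elementary symmetric polynomial. If the data are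
nonnegative and at most `M`, with sum `S ≥ k * M` and `n > k`, a Newton-type recursion in the order
sandwiches it: `((S - k M) / n) ^ k ≤ U ≤ (S / (n - k)) ^ k` (`pow_le_uStat_prodKernel`,
`uStat_prodKernel_le_pow`). Put `a = b n / √n → 0`. If `M` is a small multiple of `b n * √n = n * a`
and `S / n` is within `L * a` of `m`, both bases differ from `S / n` by a small multiple of `a`, so
differentiability of `y ^ k` at `m` gives the linearization up to `ε * a`
(`exists_eventually_abs_uStat_sub_le`).

The exceptional events are negligible at speed `b ^ 2`: some observation exceeds `δ b √n` with
probability at most `n C exp (-t₀ δ b √n)`, and `b √n` dominates both `b ^ 2` and `log n`; the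
normalized sum exceeds `L` with a Gaussian tail, and `L` is arbitrary.

For the MDP, the quadratic expansion of the cumulant generating function at `0` gives Gaussian
asymptotics for the linear part. Chernoff's bound yields the tails and exponential tilting the lower
bounds; both survive superexponentially small perturbations. -/

namespace UStatMDP

/-! ### Sandwich bounds for elementary symmetric means -/

section ElementarySymmetric

lemma uStat_prodKernel_eq (k n : ℕ) (x : Fin n → ℝ) :
    uStat (prodKernel k) n x =
      (n.choose k : ℝ)⁻¹ * ∑ s ∈ Finset.powersetCard k Finset.univ, ∏ i ∈ s, x i := by
  classical
  unfold uStat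
  congr 1
  refine Finset.sum_bij' (fun f _ => Finset.univ.image f)
    (fun s hs => s.orderEmbOfFin (Finset.mem_powersetCard.1 hs).2) ?_ ?_ ?_ ?_ ?_
  · intro f hf
    have hf' : StrictMono f := by simpa [incTuples] using hf
    simp [Finset.mem_powersetCard, Finset.card_image_of_injective _ hf'.injective]
  · intro s hs
    simpa [incTuples] using
      (s.orderEmbOfFin (Finset.mem_powersetCard.1 hs).2).strictMono
  · intro f hf
    have hf' : StrictMono f := by simpa [incTuples] using hf
    symm
    apply Finset.orderEmbOfFin_unique
    · intro j; simp
    · exact hf'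
  · intro s hs
    simp
  · intro f hf
    have hf' : StrictMono f := by simpa [incTuples] using hf
    rw [Finset.prod_image hf'.injective.injOn]
    rfl

/-- Newton-type recursion for elementary symmetric sums. -/
lemma succ_mul_sum_powersetCard_prod {ι : Type*} [Fintype ι] [DecidableEq ι] (k : ℕ)
    (x : ι → ℝ) :
    ((k : ℝ) + 1) * ∑ s ∈ Finset.powersetCard (k + 1) Finset.univ, ∏ i ∈ s, x i =
      ∑ s ∈ Finset.powersetCard k Finset.univ, (∏ i ∈ s, x i) * ∑ i ∈ sᶜ, x i := by
  have h1 : ((k : ℝ) + 1) * ∑ s ∈ Finset.powersetCard (k + 1) Finset.univ, ∏ i ∈ s, x i =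
      ∑ s ∈ Finset.powersetCard (k + 1) Finset.univ, ∑ _i ∈ s, ∏ i ∈ s, x i := by
    rw [Finset.mul_sum]
    refine Finset.sum_congr rfl fun s hs => ?_
    rw [Finset.sum_const, (Finset.mem_powersetCard.1 hs).2]
    simp
  rw [h1]
  simp_rw [Finset.mul_sum]
  rw [Finset.sum_sigma', Finset.sum_sigma']
  -- Double counting: a `(k + 1)`-set with a marked element is a `k`-set together with a point
  -- outside it.
  refine Finset.sum_bij' (fun p _ => ⟨p.1.erase p.2, p.2⟩) (fun p _ => ⟨insert p.2 p.1, p.2⟩)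
    ?_ ?_ ?_ ?_ ?_
  · rintro ⟨s, i⟩ h
    simp only [Finset.mem_sigma, Finset.mem_powersetCard, Finset.subset_univ, true_and] at h
    simp [Finset.card_erase_of_mem h.2, h.1]
  · rintro ⟨s, i⟩ h
    simp only [Finset.mem_sigma, Finset.mem_powersetCard, Finset.subset_univ, true_and,
      Finset.mem_compl] at h
    simp [Finset.card_insert_of_notMem h.2, h.1]
  · rintro ⟨s, i⟩ h
    simp only [Finset.mem_sigma] at h
    simp [Finset.insert_erase h.2]
  · rintro ⟨s, i⟩ h
    simp only [Finset.mem_sigma, Finset.mem_compl] at h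
    simp [Finset.erase_insert h.2]
  · rintro ⟨s, i⟩ h
    simp only [Finset.mem_sigma] at h
    simp [Finset.prod_erase_mul _ _ h.2]

lemma choose_succ_cast {k n : ℕ} (hk : k ≤ n) :
    ((k : ℝ) + 1) * (n.choose (k + 1) : ℝ) = n.choose k * ((n : ℝ) - k) := by
  have := Nat.choose_succ_right_eq n k
  rw [← Nat.cast_sub hk]
  have h : ((n.choose (k + 1) * (k + 1) : ℕ) : ℝ) = ((n.choose k * (n - k) : ℕ) : ℝ) := by
    rw [this]
  push_cast at h ⊢
  linarith

lemma uStat_prodKernel_nonneg {k n : ℕ} {x : Fin n → ℝ} (hx : ∀ i, 0 ≤ x i) :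
    0 ≤ uStat (prodKernel k) n x := by
  rw [uStat_prodKernel_eq]
  exact mul_nonneg (by positivity)
    (Finset.sum_nonneg fun s _ => Finset.prod_nonneg fun i _ => hx i)

lemma uStat_prodKernel_succ {k n : ℕ} (hk : k < n) (x : Fin n → ℝ) :
    ((n : ℝ) - k) * uStat (prodKernel (k + 1)) n x =
      (n.choose k : ℝ)⁻¹ *
        ∑ s ∈ Finset.powersetCard k Finset.univ, (∏ i ∈ s, x i) * ∑ i ∈ sᶜ, x i := by
  rw [uStat_prodKernel_eq, ← succ_mul_sum_powersetCard_prod]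
  have h := choose_succ_cast hk.le
  have h1 : (n.choose k : ℝ) ≠ 0 := by exact_mod_cast (Nat.choose_pos hk.le).ne'
  have h2 : (n.choose (k + 1) : ℝ) ≠ 0 := by
    exact_mod_cast (Nat.choose_pos (Nat.succ_le_of_lt hk)).ne'
  field_simp
  linear_combination -(∑ s ∈ Finset.powersetCard (k + 1) Finset.univ, ∏ i ∈ s, x i) * h

lemma uStat_prodKernel_succ_le {k n : ℕ} (hk : k < n) {x : Fin n → ℝ} (hx : ∀ i, 0 ≤ x i) :
    ((n : ℝ) - k) * uStat (prodKernel (k + 1)) n x ≤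
      uStat (prodKernel k) n x * ∑ i, x i := by
  rw [uStat_prodKernel_succ hk, uStat_prodKernel_eq, mul_assoc, Finset.sum_mul]
  gcongr with s _
  · exact Finset.prod_nonneg fun i _ => hx i
  · exact fun i _ _ => hx i
  · exact Finset.subset_univ _

/-- In the recursion, replacing the sum over the complement of a `k`-set by the full sum costs at
most `k * M`. -/
lemma le_uStat_prodKernel_succ {k n : ℕ} (hk : k < n) {x : Fin n → ℝ} {M : ℝ}
    (hx : ∀ i, 0 ≤ x i) (hM : ∀ i, x i ≤ M) :
    uStat (prodKernel k) n x * (∑ i, x i - k * M) ≤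
      ((n : ℝ) - k) * uStat (prodKernel (k + 1)) n x := by
  rw [uStat_prodKernel_succ hk, uStat_prodKernel_eq, mul_assoc, Finset.sum_mul]
  gcongr with s hs
  · exact Finset.prod_nonneg fun i _ => hx i
  · rw [← Finset.sum_add_sum_compl s x]
    have : ∑ i ∈ s, x i ≤ s.card • M := Finset.sum_le_card_nsmul _ _ _ fun i _ => hM i
    rw [(Finset.mem_powersetCard.1 hs).2, nsmul_eq_mul] at this
    linarith

lemma uStat_prodKernel_zero (n : ℕ) (x : Fin n → ℝ) : uStat (prodKernel 0) n x = 1 := by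
  simp [uStat_prodKernel_eq]

/-- Raising the order from `j` to `j + 1` multiplies the bound by `S / (n - j)`, and `n - j ≥ n - k`
makes the factor uniform in `j`. -/
lemma uStat_prodKernel_le_pow {k n : ℕ} (hk : k < n) {x : Fin n → ℝ} (hx : ∀ i, 0 ≤ x i)
    {j : ℕ} (hj : j ≤ k) :
    uStat (prodKernel j) n x ≤ ((∑ i, x i) / (n - k)) ^ j := by
  have hkn : (0 : ℝ) < n - k := by
    have : (k : ℝ) < n := by exact_mod_cast hk
    linarith
  have hS : 0 ≤ ∑ i, x i := Finset.sum_nonneg fun i _ => hx i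
  induction j with
  | zero => simp [uStat_prodKernel_zero]
  | succ j ih =>
    have hjk : (j : ℝ) ≤ k := by exact_mod_cast (Nat.le_of_succ_le hj)
    have h1 := uStat_prodKernel_succ_le (k := j) (by omega) hx
    have h2 := uStat_prodKernel_nonneg (k := j + 1) hx
    have h3 : ((n : ℝ) - k) * uStat (prodKernel (j + 1)) n x ≤
        ((∑ i, x i) / (n - k)) ^ j * ∑ i, x i := by
      calc _ ≤ ((n : ℝ) - j) * uStat (prodKernel (j + 1)) n x := by gcongr
        _ ≤ _ := h1
        _ ≤ _ := by gcongr; exact ih (by omega)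
    rw [pow_succ, mul_div_assoc', le_div_iff₀ hkn]
    linarith

/-- Each increase of the order gains at least the factor `(S - k M) / n`, whose nonnegativity, from
`hkM`, lets the induction multiply inequalities. -/
lemma pow_le_uStat_prodKernel {k n : ℕ} (hk : k < n) {x : Fin n → ℝ} {M : ℝ}
    (hx : ∀ i, 0 ≤ x i) (hM : ∀ i, x i ≤ M) (hkM : k * M ≤ ∑ i, x i) {j : ℕ} (hj : j ≤ k) :
    ((∑ i, x i - k * M) / n) ^ j ≤ uStat (prodKernel j) n x := by
  have hn : (0 : ℝ) < n := by exact_mod_cast (by omega : 0 < n)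
  have hM0 : 0 ≤ M := (hx ⟨0, by omega⟩).trans (hM _)
  induction j with
  | zero => simp [uStat_prodKernel_zero]
  | succ j ih =>
    have hjk : (j : ℝ) ≤ k := by exact_mod_cast (Nat.le_of_succ_le hj)
    have h1 := le_uStat_prodKernel_succ (k := j) (by omega) hx hM
    have h2 := uStat_prodKernel_nonneg (k := j + 1) hx
    have h0 := uStat_prodKernel_nonneg (k := j) hx
    have h3 : 0 ≤ ∑ i, x i - k * M := by linarith
    have h4 : ((∑ i, x i - k * M) / n) ^ j * (∑ i, x i - k * M) ≤
        n * uStat (prodKernel (j + 1)) n x := by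
      calc _ ≤ uStat (prodKernel j) n x * (∑ i, x i - k * M) := by
            gcongr; exact ih (by omega)
        _ ≤ uStat (prodKernel j) n x * (∑ i, x i - j * M) := by gcongr
        _ ≤ _ := h1
        _ ≤ _ := by
          gcongr
          linarith [(Nat.cast_nonneg j : (0 : ℝ) ≤ j)]
    rw [pow_succ, mul_div_assoc', div_le_iff₀ hn]
    linarith

end ElementarySymmetric

/-! ### Linearization on the good event -/

section Linearization

/-- If `U` lies between the `k`-th powers of two points close to `S`, and `S` is close to `m`,
then `U` is close to the linearization of the `k`-th power at `m`. -/
lemma exists_abs_sub_linearization_le (k : ℕ) (m : ℝ) {ε L : ℝ} (hε : 0 < ε) (hL : 0 < L) :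
    ∃ δ > 0, ∃ a₀ > 0, ∀ a S U y z : ℝ, 0 < a → a ≤ a₀ → |S - m| ≤ L * a →
      |y - S| ≤ δ * a → |z - S| ≤ δ * a → y ^ k ≤ U → U ≤ z ^ k →
      |U - m ^ k - k * m ^ (k - 1) * (S - m)| ≤ ε * a := by
  set c : ℝ := k * m ^ (k - 1) with hc
  have hd : HasDerivAt (fun y : ℝ => y ^ k) c m := hasDerivAt_pow k m
  have ho := (hasDerivAt_iff_isLittleO.1 hd).def (c := ε / (2 * (L + 1))) (by positivity)
  obtain ⟨ρ, hρ, hball⟩ := Metric.eventually_nhds_iff.1 ho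
  -- Half of `ε` pays for the Taylor remainder, half for replacing `w` by `S` in the linear term.
  -- The bound `δ ≤ 1` gives `|w - m| ≤ (L + 1) * a`, and `a₀` keeps this below `ρ`.
  refine ⟨min 1 (ε / (2 * (|c| + 1))), by positivity, ρ / (2 * (L + 1)), by positivity, ?_⟩
  set δ := min 1 (ε / (2 * (|c| + 1)))
  intro a S U y z ha haa hS hy hz hyU hUz
  have hδ1 : δ ≤ 1 := min_le_left _ _
  have hδ0 : 0 < δ := by positivity
  have hδ2 : |c| * δ ≤ ε / 2 := by
    calc |c| * δ ≤ (|c| + 1) * (ε / (2 * (|c| + 1))) := by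
          gcongr
          · linarith
          · exact min_le_right _ _
      _ = ε / 2 := by field_simp
  have key : ∀ w : ℝ, |w - S| ≤ δ * a → |w ^ k - m ^ k - c * (S - m)| ≤ ε * a := by
    intro w hw
    have hwm : |w - m| ≤ (L + 1) * a := by
      calc |w - m| ≤ |w - S| + |S - m| := abs_sub_le _ _ _
        _ ≤ δ * a + L * a := add_le_add hw hS
        _ ≤ (L + 1) * a := by nlinarith
    have hlt : dist w m < ρ := by
      rw [Real.dist_eq]
      calc |w - m| ≤ (L + 1) * a := hwm
        _ ≤ (L + 1) * (ρ / (2 * (L + 1))) := by gcongr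
        _ = ρ / 2 := by field_simp
        _ < ρ := by linarith
    have h1 := hball hlt
    simp only [Real.norm_eq_abs, smul_eq_mul] at h1
    have h2 : |w ^ k - m ^ k - (w - m) * c| ≤ ε / 2 * a := by
      calc _ ≤ ε / (2 * (L + 1)) * |w - m| := h1
        _ ≤ ε / (2 * (L + 1)) * ((L + 1) * a) := by gcongr
        _ = ε / 2 * a := by field_simp
    have h3 : |(w - S) * c| ≤ ε / 2 * a := by
      rw [abs_mul]
      calc |w - S| * |c| ≤ δ * a * |c| := by gcongr
        _ = |c| * δ * a := by ring
        _ ≤ _ := by gcongr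
    calc |w ^ k - m ^ k - c * (S - m)| = |(w ^ k - m ^ k - (w - m) * c) + (w - S) * c| := by
          congr 1; ring
      _ ≤ _ := abs_add_le _ _
      _ ≤ ε * a := by linarith
  have h1 := abs_le.1 (key y hy)
  have h2 := abs_le.1 (key z hz)
  rw [abs_le]
  constructor <;> linarith

/-- On the event that no observation exceeds `δ b √n` and the normalized sum is bounded by `L`, the
normalized U-statistic is eventually `ε`-close to its linearization. -/
lemma exists_eventually_abs_uStat_sub_le {k : ℕ} {b : ℕ → ℝ} (hb_pos : ∀ n, 0 < b n)
    (hb_top : Tendsto b atTop atTop)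
    (hb_sqrt : Tendsto (fun n : ℕ => b n / √(n : ℝ)) atTop (𝓝 0))
    {m : ℝ} (hm : 0 < m) {ε L : ℝ} (hε : 0 < ε) (hL : 0 < L) :
    ∃ δ > 0, ∀ᶠ n : ℕ in atTop, ∀ x : Fin n → ℝ, (∀ i, 0 ≤ x i) →
      (∀ i, x i ≤ δ * (b n * √n)) → |√(n : ℝ) / b n * ((n : ℝ)⁻¹ * ∑ i, (x i - m))| ≤ L →
      |√(n : ℝ) / b n * (uStat (prodKernel k) n x - m ^ k) -
        √(n : ℝ) / b n * (k * m ^ (k - 1) * ((n : ℝ)⁻¹ * ∑ i, (x i - m)))| ≤ ε := by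
  obtain ⟨δ, hδ, a₀, ha₀, H⟩ := exists_abs_sub_linearization_le k m hε hL
  -- The total loss `k * M` is then at most `δ * a * n`; `k + 1` also covers `k = 0`.
  refine ⟨δ / (k + 1), by positivity, ?_⟩
  -- The bound `1` gives `S ≤ m + L`; the bound `m / (L + δ)` gives `δ * a ≤ S`, hence `k * M ≤ ∑ i,
  -- x i`.
  have ha1 : ∀ᶠ n : ℕ in atTop, b n / √(n : ℝ) ≤ min (min a₀ 1) (m / (L + δ)) :=
    hb_sqrt.eventually_le_const (by positivity)
  filter_upwards [ha1, hb_top.eventually_ge_atTop ((m + L) * (2 * k) / δ),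
    eventually_ge_atTop (2 * k + 1)] with n ha hb hn x hx hxM hZ
  have hn0 : 0 < n := by omega
  have hnR : (0 : ℝ) < n := by exact_mod_cast hn0
  have hn1 : (1 : ℝ) ≤ n := by exact_mod_cast hn0
  have hkn : (2 : ℝ) * k + 1 ≤ n := by exact_mod_cast hn
  have hk0 : (0 : ℝ) ≤ k := Nat.cast_nonneg k
  have hsq : 0 < √(n : ℝ) := Real.sqrt_pos.2 hnR
  have hsq2 : √(n : ℝ) * √(n : ℝ) = n := Real.mul_self_sqrt hnR.le
  have hbn := hb_pos n
  set a := b n / √(n : ℝ) with ha_def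
  have ha0 : 0 < a := by positivity
  have hab : √(n : ℝ) / b n = a⁻¹ := by rw [ha_def, inv_div]
  have hMa : b n * √(n : ℝ) = n * a := by
    rw [ha_def]; field_simp; linarith
  set S : ℝ := (∑ i, x i) / n with hS_def
  have hS : (n : ℝ)⁻¹ * ∑ i, (x i - m) = S - m := by
    rw [Finset.sum_sub_distrib, hS_def]
    simp
    field_simp
  have hsum : ∑ i, x i = n * S := by rw [hS_def]; field_simp
  rw [hS, hab] at hZ ⊢
  have hSm : |S - m| ≤ L * a := by
    rw [abs_mul, abs_of_pos (inv_pos.2 ha0), inv_mul_le_iff₀ ha0] at hZ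
    linarith
  have haa : a ≤ a₀ := ha.trans ((min_le_left _ _).trans (min_le_left _ _))
  have haa1 : a ≤ 1 := ha.trans ((min_le_left _ _).trans (min_le_right _ _))
  have ham : (L + δ) * a ≤ m := by
    have := ha.trans (min_le_right _ _)
    rw [le_div_iff₀ (by positivity)] at this
    linarith
  set M := δ / (k + 1) * (b n * √(n : ℝ)) with hM_def
  have hkM : k * M ≤ δ * a * n := by
    rw [hM_def, hMa]
    have : k * (δ / (k + 1) * (n * a)) = (k / (k + 1) : ℝ) * (δ * a * n) := by ring
    rw [this]
    have h1 : (k / (k + 1) : ℝ) ≤ 1 := by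
      rw [div_le_one (by positivity)]; linarith
    exact mul_le_of_le_one_left (by positivity) h1
  have hM0 : 0 ≤ k * M := by positivity
  have hSl := abs_le.1 hSm
  have hSδ : δ * a ≤ S := by linarith [add_mul L δ a]
  have hlow := pow_le_uStat_prodKernel (k := k) (n := n) (by omega) hx hxM
    (hkM.trans (by rw [hsum, mul_comm]; gcongr)) le_rfl
  have hupp := uStat_prodKernel_le_pow (k := k) (n := n) (by omega) hx le_rfl
  have hnk : (0 : ℝ) < n - k := by linarith
  have hy : |(∑ i, x i - k * M) / n - S| ≤ δ * a := by
    have : (∑ i, x i - k * M) / n - S = -(k * M / n) := by rw [hS_def]; ring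
    rw [this, abs_neg, abs_of_nonneg (by positivity), div_le_iff₀ hnR]
    exact hkM
  -- The bias `S * k / (n - k)` is of order `1 / n`, while `δ * a = δ * b n / √n`; the lower bound
  -- on `b n` makes it negligible.
  have hz : |(∑ i, x i) / (n - k) - S| ≤ δ * a := by
    have : (∑ i, x i) / (n - k) - S = S * k / (n - k) := by
      rw [hsum]; field_simp; ring
    have hS0 : 0 ≤ S := (by positivity : 0 ≤ δ * a).trans hSδ
    rw [this, abs_of_nonneg (by positivity), div_le_iff₀ hnk]
    have h1 : S ≤ m + L := by linarith [mul_le_of_le_one_right hL.le haa1]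
    rw [div_le_iff₀ hδ] at hb
    have h2 : b n ≤ n * a := by
      rw [← hMa]
      exact le_mul_of_one_le_right hbn.le (Real.one_le_sqrt.2 hn1)
    have h3 : n / 2 ≤ (n : ℝ) - k := by linarith
    calc S * k ≤ (m + L) * k := by gcongr
      _ ≤ b n * δ / 2 := by linarith
      _ ≤ n * a * δ / 2 := by gcongr
      _ = δ * a * (n / 2) := by ring
      _ ≤ _ := by gcongr
  have := H a S _ _ _ ha0 haa hSm hy hz hlow hupp
  rw [← mul_sub, abs_mul, abs_of_pos (inv_pos.2 ha0), inv_mul_le_iff₀ ha0]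
  linarith

end Linearization

/-! ### A Gaussian LDP criterion and its stability -/

section LargeDeviations

lemma ennrealLog_div_le_iff {p : ℝ≥0∞} {r s : ℝ} (hs : 0 < s) :
    ENNReal.log p / (s : EReal) ≤ r ↔ p ≤ ENNReal.ofReal (Real.exp (r * s)) := by
  rw [EReal.div_le_iff_le_mul (by exact_mod_cast hs) (EReal.coe_ne_top s), ← EReal.coe_mul,
    ← ENNReal.log_le_log_iff, ENNReal.log_ofReal_of_pos (Real.exp_pos _), Real.log_exp,
    mul_comm]

lemma le_ennrealLog_div_iff {p : ℝ≥0∞} {r s : ℝ} (hs : 0 < s) :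
    (r : EReal) ≤ ENNReal.log p / (s : EReal) ↔ ENNReal.ofReal (Real.exp (r * s)) ≤ p := by
  rw [EReal.le_div_iff_mul_le (by exact_mod_cast hs) (EReal.coe_ne_top s), ← EReal.coe_mul,
    ← ENNReal.log_le_log_iff, ENNReal.log_ofReal_of_pos (Real.exp_pos _), Real.log_exp]

/-- An arbitrarily small loss in the rate absorbs the factor `2` of a union bound. -/
lemma eventually_two_mul_exp_le {s : ℕ → ℝ} (hs : Tendsto s atTop atTop) {a b : ℝ}
    (hab : a < b) : ∀ᶠ n in atTop, 2 * Real.exp (a * s n) ≤ Real.exp (b * s n) := by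
  filter_upwards [hs.eventually_ge_atTop (1 / (b - a))] with n hn
  have h : 0 < b - a := sub_pos.2 hab
  rw [div_le_iff₀ h] at hn
  have h1 : Real.exp (b * s n) = Real.exp ((b - a) * s n) * Real.exp (a * s n) := by
    rw [← Real.exp_add]; ring_nf
  rw [h1]
  gcongr
  linarith [Real.add_one_le_exp ((b - a) * s n)]

variable {Ω : Type*} [MeasurableSpace Ω] {μ : Measure Ω} [IsProbabilityMeasure μ]

lemma expEquivalent_of_forall_eventually_le {ξ η : ℕ → Ω → ℝ} {s : ℕ → ℝ}
    (hs : Tendsto s atTop atTop)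
    (h : ∀ ε > 0, ∀ r : ℝ, ∀ᶠ n in atTop,
      μ.real {ω | ε < |ξ n ω - η n ω|} ≤ Real.exp (r * s n)) :
    ExpEquivalent μ ξ η s := by
  intro ε hε
  rw [EReal.tendsto_nhds_bot_iff_real]
  intro x
  filter_upwards [h ε hε (x - 1), hs.eventually_gt_atTop 0] with n hn hsn
  refine lt_of_le_of_lt ((ennrealLog_div_le_iff hsn).2 ?_)
    (EReal.coe_lt_coe_iff.2 (sub_one_lt x))
  rw [← ofReal_measureReal]
  exact ENNReal.ofReal_le_ofReal hn

/-- A criterion for the large deviations principle on `ℝ` with Gaussian rate function in terms of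
tails and small intervals. -/
lemma satisfiesLDP_gaussian {ξ : ℕ → Ω → ℝ} {s : ℕ → ℝ} (hs : Tendsto s atTop atTop) {v : ℝ}
    (hv : 0 < v)
    (hlow : ∀ x : ℝ, ∀ δ > 0, ∀ r < -(x ^ 2 / (2 * v)), ∀ᶠ n in atTop,
      Real.exp (r * s n) ≤ μ.real {ω | |ξ n ω - x| < δ})
    (hup : ∀ c > 0, ∀ r > -(c ^ 2 / (2 * v)), ∀ᶠ n in atTop,
      μ.real {ω | c ≤ |ξ n ω|} ≤ Real.exp (r * s n)) :
    SatisfiesLDP μ ξ s (fun x => ENNReal.ofReal (x ^ 2 / (2 * v))) := by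
  have hcoe : ∀ x : ℝ, ((ENNReal.ofReal (x ^ 2 / (2 * v)) : ℝ≥0∞) : EReal) =
      ((x ^ 2 / (2 * v) : ℝ) : EReal) := fun x => by
    rw [EReal.coe_ennreal_ofReal, max_eq_left (by positivity)]
  refine ⟨hs, ⟨⟨0, ENNReal.ofReal_ne_top⟩, ?_⟩, ?_, ?_⟩
  · intro a ha
    refine (isCompact_closedBall (0 : ℝ) (√(a.toReal * (2 * v)))).of_isClosed_subset ?_ ?_
    · exact isClosed_le (ENNReal.continuous_ofReal.comp (by fun_prop)) continuous_const
    · intro x hx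
      have h1 : x ^ 2 / (2 * v) ≤ a.toReal := by
        have := ENNReal.toReal_mono ha hx
        rwa [ENNReal.toReal_ofReal (by positivity)] at this
      rw [div_le_iff₀ (by positivity)] at h1
      rw [mem_closedBall_zero_iff, Real.norm_eq_abs]
      exact Real.abs_le_sqrt h1
  · intro A _
    rw [EReal.neg_le]
    refine le_iInf₂ fun x hx => ?_
    rw [hcoe, EReal.neg_le, ← EReal.coe_neg]
    refine EReal.ge_of_forall_gt_iff_ge.1 fun r hr => ?_
    obtain ⟨δ, hδ, hball⟩ := Metric.isOpen_iff.1 isOpen_interior x hx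
    refine le_liminf_of_le (by isBoundedDefault) ?_
    filter_upwards [hlow x δ hδ r (EReal.coe_lt_coe_iff.1 hr), hs.eventually_gt_atTop 0]
      with n hn hsn
    rw [le_ennrealLog_div_iff hsn]
    refine (ENNReal.ofReal_le_ofReal hn).trans ?_
    rw [ofReal_measureReal]
    refine measure_mono fun ω hω => ?_
    have hωA : ξ n ω ∈ interior A := hball (by rwa [Metric.mem_ball, Real.dist_eq])
    exact (interior_subset hωA : ξ n ω ∈ A)
  · intro A _
    refine EReal.le_of_forall_lt_iff_le.1 fun z hz => ?_
    refine limsup_le_of_le (by isBoundedDefault) ?_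
    rcases A.eq_empty_or_nonempty with rfl | hA
    · filter_upwards [hs.eventually_gt_atTop 0] with n hsn
      rw [ennrealLog_div_le_iff hsn]
      simp
    -- The rate increases with `|x|`, so its infimum over the closure is attained at a point nearest
    -- to `0`, and `A` lies in the two-sided tail at `|y|`.
    obtain ⟨y, hy, hdist⟩ := isClosed_closure.exists_infDist_eq_dist hA.closure (0 : ℝ)
    rw [dist_zero_left, Real.norm_eq_abs, Metric.infDist_closure] at hdist
    have hz' : -(|y| ^ 2 / (2 * v)) < z := by
      rw [← EReal.coe_lt_coe_iff, EReal.coe_neg, sq_abs]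
      refine lt_of_le_of_lt ?_ hz
      rw [← hcoe]
      exact EReal.neg_le_neg_iff.2 (iInf₂_le y hy)
    rcases eq_or_ne y 0 with rfl | hy0
    · have hz0 : 0 < z := by simpa using hz'
      filter_upwards [hs.eventually_gt_atTop 0] with n hsn
      rw [ennrealLog_div_le_iff hsn]
      refine prob_le_one.trans ?_
      rw [← ENNReal.ofReal_one]
      exact ENNReal.ofReal_le_ofReal (Real.one_le_exp (by positivity))
    · filter_upwards [hup |y| (abs_pos.2 hy0) z hz', hs.eventually_gt_atTop 0] with n hn hsn
      rw [ennrealLog_div_le_iff hsn]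
      refine le_trans ?_ (ENNReal.ofReal_le_ofReal hn)
      rw [ofReal_measureReal]
      refine measure_mono fun ω hω => ?_
      rw [Set.mem_ofPred_eq, ← hdist, ← Real.norm_eq_abs, ← dist_zero_left]
      exact Metric.infDist_le_dist_of_mem hω

/-- Gaussian tail bounds are stable under superexponentially small perturbations. -/
lemma eventually_measureReal_le_abs_of_expClose {ξ η : ℕ → Ω → ℝ} {s : ℕ → ℝ}
    (hs : Tendsto s atTop atTop) {v : ℝ}
    (hclose : ∀ ε > 0, ∀ r : ℝ, ∀ᶠ n in atTop,
      μ.real {ω | ε < |ξ n ω - η n ω|} ≤ Real.exp (r * s n))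
    (hup : ∀ c > 0, ∀ r > -(c ^ 2 / (2 * v)), ∀ᶠ n in atTop,
      μ.real {ω | c ≤ |η n ω|} ≤ Real.exp (r * s n))
    {c : ℝ} (hc : 0 < c) {r : ℝ} (hr : -(c ^ 2 / (2 * v)) < r) :
    ∀ᶠ n in atTop, μ.real {ω | c ≤ |ξ n ω|} ≤ Real.exp (r * s n) := by
  obtain ⟨r', hr', hrr⟩ := exists_between hr
  have hcont : Tendsto (fun d : ℝ => -(d ^ 2 / (2 * v))) (𝓝[<] c) (𝓝 (-(c ^ 2 / (2 * v)))) :=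
    ((by fun_prop : Continuous fun d : ℝ => -(d ^ 2 / (2 * v))).tendsto c).mono_left
      nhdsWithin_le_nhds
  -- By continuity of the rate, `d < c` still has rate better than `r'`, leaving `c - d` as room for
  -- the perturbation.
  obtain ⟨d, hd, hd0, hdc⟩ := ((hcont.eventually_lt_const hr').and
    (Ioo_mem_nhdsLT hc)).exists
  filter_upwards [hclose (c - d) (sub_pos.2 hdc) r', hup d hd0 r' hd,
    eventually_two_mul_exp_le hs hrr] with n h1 h2 h3
  calc μ.real {ω | c ≤ |ξ n ω|}
      ≤ μ.real ({ω | c - d < |ξ n ω - η n ω|} ∪ {ω | d ≤ |η n ω|}) := by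
        refine measureReal_mono fun ω hω => ?_
        simp only [Set.mem_union, Set.mem_ofPred_eq] at hω ⊢
        by_contra! hcon
        have := abs_sub_abs_le_abs_sub (ξ n ω) (η n ω)
        linarith [hcon.1, hcon.2]
    _ ≤ _ := measureReal_union_le _ _
    _ ≤ Real.exp (r * s n) := by linarith

/-- Lower bounds on small intervals are stable under superexponentially small perturbations. -/
lemma eventually_le_measureReal_of_expClose {ξ η : ℕ → Ω → ℝ} {s : ℕ → ℝ}
    (hs : Tendsto s atTop atTop) {v : ℝ}
    (hclose : ∀ ε > 0, ∀ r : ℝ, ∀ᶠ n in atTop,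
      μ.real {ω | ε < |ξ n ω - η n ω|} ≤ Real.exp (r * s n))
    (hlow : ∀ x : ℝ, ∀ δ > 0, ∀ r < -(x ^ 2 / (2 * v)), ∀ᶠ n in atTop,
      Real.exp (r * s n) ≤ μ.real {ω | |η n ω - x| < δ})
    (x : ℝ) {δ : ℝ} (hδ : 0 < δ) {r : ℝ} (hr : r < -(x ^ 2 / (2 * v))) :
    ∀ᶠ n in atTop, Real.exp (r * s n) ≤ μ.real {ω | |ξ n ω - x| < δ} := by
  obtain ⟨r', hrr, hr'⟩ := exists_between hr
  filter_upwards [hclose (δ / 2) (half_pos hδ) r, hlow x (δ / 2) (half_pos hδ) r' hr',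
    eventually_two_mul_exp_le hs hrr] with n h1 h2 h3
  have : μ.real {ω | |η n ω - x| < δ / 2} ≤
      μ.real {ω | |ξ n ω - x| < δ} + μ.real {ω | δ / 2 < |ξ n ω - η n ω|} := by
    refine le_trans (measureReal_mono fun ω hω => ?_) (measureReal_union_le _ _)
    simp only [Set.mem_union, Set.mem_ofPred_eq] at hω ⊢
    by_contra! hcon
    have := abs_sub_le (ξ n ω) (η n ω) x
    linarith [hcon.1, hcon.2]
  linarith

end LargeDeviations

/-! ### From generating functions to Gaussian deviations -/

section MomentGeneratingFunction

variable {Ω : Type*} [MeasurableSpace Ω] {μ : Measure Ω} [IsProbabilityMeasure μ]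

/-- Gaussian tail bound from Gaussian bounds on the moment generating functions. -/
lemma eventually_measureReal_le_abs_of_mgf {Z : ℕ → Ω → ℝ} {s : ℕ → ℝ}
    (hs : Tendsto s atTop atTop) {v : ℝ} (hv : 0 < v)
    (hint : ∀ t : ℝ, ∀ᶠ n in atTop, Integrable (fun ω => Real.exp (t * s n * Z n ω)) μ)
    (hmgf : ∀ t : ℝ, ∀ r > v * t ^ 2 / 2, ∀ᶠ n in atTop,
      mgf (Z n) μ (t * s n) ≤ Real.exp (r * s n))
    {c : ℝ} (hc : 0 < c) {r : ℝ} (hr : -(c ^ 2 / (2 * v)) < r) :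
    ∀ᶠ n in atTop, μ.real {ω | c ≤ |Z n ω|} ≤ Real.exp (r * s n) := by
  obtain ⟨r', hr', hrr⟩ := exists_between hr
  -- The tilt `c / v` minimizes the Chernoff exponent `v * t ^ 2 / 2 - t * c`.
  have ht : 0 < c / v := by positivity
  have hkey : v * (c / v) ^ 2 / 2 < r' + c / v * c := by
    have h1 : v * (c / v) ^ 2 / 2 = c / v * c - c ^ 2 / (2 * v) := by field_simp; ring
    linarith
  have hkey' : v * (-(c / v)) ^ 2 / 2 < r' + c / v * c := by rwa [neg_sq]
  filter_upwards [hint (c / v), hint (-(c / v)), hmgf (c / v) _ hkey, hmgf (-(c / v)) _ hkey',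
    eventually_two_mul_exp_le hs hrr, hs.eventually_gt_atTop 0] with n hi1 hi2 hm1 hm2 h2 hsn
  have hts : 0 < c / v * s n := by positivity
  have e1 := measure_ge_le_exp_mul_mgf (X := Z n) c hts.le hi1
  have e2 := measure_le_le_exp_mul_mgf (X := Z n) (-c) (t := -(c / v) * s n)
    (by linarith) hi2
  have f1 : Real.exp (-(c / v * s n) * c) * mgf (Z n) μ (c / v * s n) ≤
      Real.exp (r' * s n) := by
    calc _ ≤ Real.exp (-(c / v * s n) * c) * Real.exp ((r' + c / v * c) * s n) := by gcongr
      _ = _ := by rw [← Real.exp_add]; ring_nf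
  have f2 : Real.exp (-(-(c / v) * s n) * -c) * mgf (Z n) μ (-(c / v) * s n) ≤
      Real.exp (r' * s n) := by
    calc _ ≤ Real.exp (-(-(c / v) * s n) * -c) * Real.exp ((r' + c / v * c) * s n) := by gcongr
      _ = _ := by rw [← Real.exp_add]; ring_nf
  calc μ.real {ω | c ≤ |Z n ω|} ≤ μ.real ({ω | c ≤ Z n ω} ∪ {ω | Z n ω ≤ -c}) := by
        refine measureReal_mono fun ω hω => ?_
        rcases le_abs.1 (show c ≤ |Z n ω| from hω) with h | h
        · exact Or.inl h
        · exact Or.inr (show Z n ω ≤ -c by linarith)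
    _ ≤ _ := measureReal_union_le _ _
    _ ≤ Real.exp (r * s n) := by linarith

/-- Exponential change of measure: the moment generating function at `t` is controlled by the
probability of an interval and by the moment generating function at `t ± u`. -/
lemma mgf_le_measureReal_interval_add {Z : Ω → ℝ} (hZ : Measurable Z) {t u x δ : ℝ}
    (hu : 0 ≤ u)
    (h0 : Integrable (fun ω => Real.exp (t * Z ω)) μ)
    (h1 : Integrable (fun ω => Real.exp ((t + u) * Z ω)) μ)
    (h2 : Integrable (fun ω => Real.exp ((t - u) * Z ω)) μ) :
    mgf Z μ t ≤ Real.exp (t * x + |t| * δ) * μ.real {ω | |Z ω - x| < δ} +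
      Real.exp (-u * (x + δ)) * mgf Z μ (t + u) + Real.exp (u * (x - δ)) * mgf Z μ (t - u) := by
  have hA : MeasurableSet {ω | |Z ω - x| < δ} :=
    measurableSet_lt (by fun_prop) measurable_const
  have hiA : Integrable ({ω | |Z ω - x| < δ}.indicator (fun _ => (1 : ℝ))) μ :=
    (integrable_const _).indicator hA
  have hi01 : Integrable (fun ω =>
      Real.exp (t * x + |t| * δ) * {ω | |Z ω - x| < δ}.indicator (fun _ => (1 : ℝ)) ω +
        Real.exp (-u * (x + δ)) * Real.exp ((t + u) * Z ω)) μ :=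
    (hiA.const_mul _).add (h1.const_mul _)
  have hE : Real.exp (t * x + |t| * δ) * μ.real {ω | |Z ω - x| < δ} +
      Real.exp (-u * (x + δ)) * mgf Z μ (t + u) + Real.exp (u * (x - δ)) * mgf Z μ (t - u) =
      ∫ ω, (Real.exp (t * x + |t| * δ) * {ω | |Z ω - x| < δ}.indicator (fun _ => (1 : ℝ)) ω +
        Real.exp (-u * (x + δ)) * Real.exp ((t + u) * Z ω) +
        Real.exp (u * (x - δ)) * Real.exp ((t - u) * Z ω)) ∂μ := by
    rw [integral_add hi01 (h2.const_mul _), integral_add (hiA.const_mul _) (h1.const_mul _), integral_const_mul, integral_const_mul,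
      integral_const_mul, integral_indicator_const _ hA]
    simp [mgf]
  rw [hE]
  refine integral_mono h0 (hi01.add (h2.const_mul _)) ?_
  intro ω
  have p1 : 0 < Real.exp (-u * (x + δ)) * Real.exp ((t + u) * Z ω) := by positivity
  have p2 : 0 < Real.exp (u * (x - δ)) * Real.exp ((t - u) * Z ω) := by positivity
  by_cases hω : |Z ω - x| < δ
  · have : Real.exp (t * Z ω) ≤ Real.exp (t * x + |t| * δ) := by
      apply Real.exp_le_exp.2
      have h3 : t * (Z ω - x) ≤ |t| * δ :=
        (le_abs_self _).trans (by rw [abs_mul]; gcongr)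
      linarith
    simp only [Set.indicator, Set.mem_ofPred_eq, hω, if_true, mul_one]
    linarith
  · simp only [Set.indicator, Set.mem_ofPred_eq, hω, if_false, mul_zero, zero_add]
    -- Outside the interval, an extra tilt by `u` towards the side where `Z` lies only increases the
    -- integrand.
    rcases le_abs.1 (not_lt.1 hω) with h | h
    · have : Real.exp (t * Z ω) ≤ Real.exp (-u * (x + δ)) * Real.exp ((t + u) * Z ω) := by
        rw [← Real.exp_add]
        apply Real.exp_le_exp.2
        nlinarith [mul_le_mul_of_nonneg_left h hu]
      linarith
    · have : Real.exp (t * Z ω) ≤ Real.exp (u * (x - δ)) * Real.exp ((t - u) * Z ω) := by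
        rw [← Real.exp_add]
        apply Real.exp_le_exp.2
        nlinarith [mul_le_mul_of_nonneg_left h hu]
      linarith

/-- Gaussian lower bound on small intervals from Gaussian asymptotics of the moment generating
functions. -/
lemma eventually_le_measureReal_of_mgf {Z : ℕ → Ω → ℝ} (hZ : ∀ n, Measurable (Z n)) {s : ℕ → ℝ}
    (hs : Tendsto s atTop atTop) {v : ℝ} (hv : 0 < v)
    (hint : ∀ t : ℝ, ∀ᶠ n in atTop, Integrable (fun ω => Real.exp (t * s n * Z n ω)) μ)
    (hmgf : ∀ t : ℝ, ∀ r > v * t ^ 2 / 2, ∀ᶠ n in atTop,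
      mgf (Z n) μ (t * s n) ≤ Real.exp (r * s n))
    (hmgf' : ∀ t : ℝ, ∀ r < v * t ^ 2 / 2, ∀ᶠ n in atTop,
      Real.exp (r * s n) ≤ mgf (Z n) μ (t * s n))
    (x : ℝ) {δ : ℝ} (hδ : 0 < δ) {r : ℝ} (hr : r < -(x ^ 2 / (2 * v))) :
    ∀ᶠ n in atTop, Real.exp (r * s n) ≤ μ.real {ω | |Z n ω - x| < δ} := by
  set g := -(x ^ 2 / (2 * v)) - r with hg
  have hg0 : 0 < g := by linarith
  -- On the shrunken interval of radius `d`, the total loss `|t| * d + 2 * γ` in the exponent is at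
  -- most `g`.
  set d := min (min δ 1) (g * v / (|x| + 1)) with hd
  have hd0 : 0 < d := by positivity
  have hdδ : d ≤ δ := (min_le_left _ _).trans (min_le_left _ _)
  have hd1 : d ≤ 1 := (min_le_left _ _).trans (min_le_right _ _)
  have hdg : (|x| + 1) * d ≤ g * v := by
    have : d ≤ g * v / (|x| + 1) := min_le_right _ _
    rwa [le_div_iff₀ (by positivity), mul_comm] at this
  -- The tilt `t` centres the Gaussian at `x`. With `u = d / v`, both side terms have exponent `q +
  -- 4 * γ - u * d = q - 4 * γ`, strictly below that of the main term, `q`.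
  set t := x / v with ht
  set u := d / v with hu
  have hu0 : 0 < u := by positivity
  set γ := d ^ 2 / (8 * v) with hγ
  have hγ0 : 0 < γ := by positivity
  set q := x ^ 2 / (2 * v) with hq
  have hq' : v * t ^ 2 / 2 = q := by rw [ht, hq]; field_simp
  have hplus : v * (t + u) ^ 2 / 2 = q + u * x + 4 * γ := by
    rw [ht, hq, hu, hγ]; field_simp; ring
  have hminus : v * (t - u) ^ 2 / 2 = q - u * x + 4 * γ := by
    rw [ht, hq, hu, hγ]; field_simp; ring
  have hud : u * d = 8 * γ := by rw [hu, hγ]; field_simp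
  have hfin : r ≤ q - 2 * γ - (t * x + |t| * d) := by
    have e1 : t * x = 2 * q := by rw [ht, hq]; field_simp
    have e2 : |t| * d = |x| * d / v := by rw [ht, abs_div, abs_of_pos hv]; ring
    have e3 : 2 * γ ≤ d / v := by
      rw [hγ, mul_div_assoc', div_le_div_iff₀ (by positivity) hv]
      have : d ^ 2 ≤ d := by nlinarith
      nlinarith [mul_le_mul_of_nonneg_right this hv.le, mul_pos hd0 hv]
    have e4 : |x| * d / v + d / v ≤ g := by
      rw [← add_div, div_le_iff₀ hv]; linarith
    rw [e1, e2]
    linarith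
  -- With slack `γ` in each estimate, the side terms have rate `q - 3 * γ` and the mgf at least `q -
  -- γ`; absorbing two factors of `2` leaves `q - 2 * γ` for the interval.
  filter_upwards [hint t, hint (t + u), hint (t - u),
    hmgf' t (q - γ) (by rw [hq']; linarith),
    hmgf (t + u) (q + u * x + 5 * γ) (by rw [hplus]; linarith),
    hmgf (t - u) (q - u * x + 5 * γ) (by rw [hminus]; linarith),
    eventually_two_mul_exp_le hs (show q - 3 * γ < q - 2 * γ by linarith),
    eventually_two_mul_exp_le hs (show q - 2 * γ < q - γ by linarith),
    hs.eventually_gt_atTop 0] with n i0 i1 i2 m0 m1 m2 x1 x2 hsn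
  have main := mgf_le_measureReal_interval_add (μ := μ) (hZ n) (t := t * s n) (u := u * s n)
    (x := x) (δ := d) (by positivity) i0 (by rwa [← add_mul]) (by rwa [← sub_mul])
  rw [← add_mul, ← sub_mul, abs_mul, abs_of_pos hsn] at main
  have b1 : Real.exp (-(u * s n) * (x + d)) * mgf (Z n) μ ((t + u) * s n) ≤
      Real.exp ((q - 3 * γ) * s n) := by
    calc _ ≤ Real.exp (-(u * s n) * (x + d)) * Real.exp ((q + u * x + 5 * γ) * s n) := by
          gcongr
      _ = _ := by
        rw [← Real.exp_add]
        congr 1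
        linear_combination -(s n) * hud
  have b2 : Real.exp (u * s n * (x - d)) * mgf (Z n) μ ((t - u) * s n) ≤
      Real.exp ((q - 3 * γ) * s n) := by
    calc _ ≤ Real.exp (u * s n * (x - d)) * Real.exp ((q - u * x + 5 * γ) * s n) := by
          gcongr
      _ = _ := by
        rw [← Real.exp_add]
        congr 1
        linear_combination -(s n) * hud
  have b3 : Real.exp ((q - 2 * γ) * s n) ≤
      Real.exp (t * s n * x + |t| * s n * d) * μ.real {ω | |Z n ω - x| < d} := by linarith
  calc Real.exp (r * s n) ≤ Real.exp ((q - 2 * γ - (t * x + |t| * d)) * s n) := by gcongr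
    _ = (Real.exp (t * s n * x + |t| * s n * d))⁻¹ * Real.exp ((q - 2 * γ) * s n) := by
      rw [← Real.exp_neg, ← Real.exp_add]; ring_nf
    _ ≤ μ.real {ω | |Z n ω - x| < d} := by
      rwa [inv_mul_le_iff₀ (Real.exp_pos _)]
    _ ≤ μ.real {ω | |Z n ω - x| < δ} :=
      measureReal_mono fun ω hω => lt_of_lt_of_le (show |Z n ω - x| < d from hω) hdδ

end MomentGeneratingFunction

/-! ### Normalized i.i.d. sums and their maximum -/

section IIDSums

/-- At speed `b ^ 2`, a tilt `t` of the normalized sum acts on each summand with parameter `t * c *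
b n / √n → 0`, so only the generating function near `0` matters. -/
lemma mul_normalizedSum_eq {Ω : Type*} {X : ℕ → Ω → ℝ} {b : ℕ → ℝ} {m : ℝ} {n : ℕ} (hn : 0 < n) (hb : 0 < b n) (c t : ℝ) (ω : Ω) :
    t * b n ^ 2 * (√(n : ℝ) / b n * (c * ((n : ℝ)⁻¹ * ∑ i ∈ Finset.range n, (X i ω - m)))) =
      t * c * (b n / √(n : ℝ)) * (∑ i ∈ Finset.range n, fun ω => X i ω - m) ω := by
  have hnR : (0 : ℝ) < n := by exact_mod_cast hn
  have hsq : 0 < √(n : ℝ) := Real.sqrt_pos.2 hnR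
  have hsq2 : √(n : ℝ) ^ 2 = n := Real.sq_sqrt hnR.le
  rw [Finset.sum_apply]
  field_simp
  rw [hsq2]
  ring

lemma eventually_mem_integrableExpSet {Ω : Type*} [MeasurableSpace Ω]
    {μ : Measure Ω} {b : ℕ → ℝ} {Y : Ω → ℝ}
    (hb_sqrt : Tendsto (fun n : ℕ => b n / √(n : ℝ)) atTop (𝓝 0))
    (h0 : 0 ∈ interior (integrableExpSet Y μ)) (a : ℝ) :
    ∀ᶠ n : ℕ in atTop, a * (b n / √(n : ℝ)) ∈ integrableExpSet Y μ := by
  have h1 : Tendsto (fun n : ℕ => a * (b n / √(n : ℝ))) atTop (𝓝 0) := by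
    simpa using hb_sqrt.const_mul a
  exact h1.eventually (mem_interior_iff_mem_nhds.1 h0)

variable {Ω : Type*} [MeasurableSpace Ω] {μ : Measure Ω} [IsProbabilityMeasure μ]

/-- Second order expansion at `0` of the cumulant generating function of a centered variable. -/
lemma cgf_sub_variance_isLittleO {Y : Ω → ℝ} (h0 : 0 ∈ interior (integrableExpSet Y μ))
    (hY : ∫ ω, Y ω ∂μ = 0) :
    (fun h => cgf Y μ h - Var[Y; μ] / 2 * h ^ 2) =o[𝓝 0] fun h => h ^ 2 := by
  have hd : deriv (cgf Y μ) 0 = 0 := by rw [deriv_cgf_zero h0, hY, zero_div]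
  have hd2 : iteratedDeriv 2 (cgf Y μ) 0 = Var[Y; μ] := by
    rw [iteratedDeriv_two_cgf_eq_integral h0, hd,
      variance_of_integral_eq_zero (aemeasurable_of_mem_interior_integrableExpSet h0) hY]
    simp
  -- The terms of degree `0` and `1` vanish, so the Taylor polynomial below degree `3` is the
  -- variance term alone.
  have hO := (analyticAt_cgf h0).hasFPowerSeriesAt.isBigO_sub_partialSum_pow 3
  have hO' : (fun h => cgf Y μ h - Var[Y; μ] / 2 * h ^ 2) =O[𝓝 0] fun h : ℝ => h ^ 3 := by
    rw [← Asymptotics.isBigO_norm_right]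
    simp only [norm_pow]
    refine hO.congr_left fun h => ?_
    simp [FormalMultilinearSeries.partialSum, Finset.sum_range_succ, hd, hd2, cgf_zero,
      mul_comm]
  exact hO'.trans_isLittleO (Asymptotics.isLittleO_pow_pow (by norm_num))

/-- For a nonnegative variable every exponent below `t₀` is dominated by `1 + exp (t₀ * X)`, so one
positive exponential moment suffices. -/
lemma zero_mem_interior_integrableExpSet_sub_const {X : Ω → ℝ} (hX : AEMeasurable X μ)
    (hnonneg : ∀ᵐ ω ∂μ, 0 ≤ X ω) {t₀ : ℝ} (ht₀ : 0 < t₀)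
    (hexp : Integrable (fun ω => Real.exp (t₀ * X ω)) μ) (m : ℝ) :
    0 ∈ interior (integrableExpSet (fun ω => X ω - m) μ) := by
  rw [mem_interior]
  refine ⟨Set.Iio t₀, fun t ht => ?_, isOpen_Iio, ht₀⟩
  have h1 : Integrable (fun ω => Real.exp (t * X ω)) μ := by
    refine (hexp.add (integrable_const 1)).mono' (by fun_prop) ?_
    filter_upwards [hnonneg] with ω hω
    rw [Real.norm_eq_abs, abs_of_pos (Real.exp_pos _)]
    have : Real.exp (t * X ω) ≤ Real.exp (t₀ * X ω) :=
      Real.exp_le_exp.2 (mul_le_mul_of_nonneg_right (le_of_lt ht) hω)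
    simp only [Pi.add_apply]
    linarith
  refine (h1.mul_const (Real.exp (-(t * m)))).congr (ae_of_all _ fun ω => ?_)
  simp only [← Real.exp_add]
  ring_nf

variable {X : ℕ → Ω → ℝ} {b : ℕ → ℝ} {m : ℝ}

lemma integrable_exp_normalizedSum (hmeas : ∀ i, Measurable (X i)) (hindep : iIndepFun X μ)
    (hident : ∀ i, IdentDistrib (X i) (X 0) μ μ) {n : ℕ} (hn : 0 < n) (hb : 0 < b n) {c t : ℝ}
    (h : t * c * (b n / √(n : ℝ)) ∈ integrableExpSet (fun ω => X 0 ω - m) μ) :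
    Integrable (fun ω => Real.exp (t * b n ^ 2 *
      (√(n : ℝ) / b n * (c * ((n : ℝ)⁻¹ * ∑ i ∈ Finset.range n, (X i ω - m)))))) μ := by
  simp_rw [mul_normalizedSum_eq hn hb]
  have hind : iIndepFun (fun i ω => X i ω - m) μ :=
    hindep.comp (fun _ x => x - m) fun _ => by fun_prop
  refine hind.integrable_exp_mul_sum (fun i => (hmeas i).sub_const m) fun i _ => ?_
  exact ((hident i).comp
    (by fun_prop : Measurable fun x => Real.exp (t * c * (b n / √(n : ℝ)) * (x - m)))).integrable_iff.2
    h

lemma mgf_normalizedSum (hmeas : ∀ i, Measurable (X i)) (hindep : iIndepFun X μ)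
    (hident : ∀ i, IdentDistrib (X i) (X 0) μ μ) {n : ℕ} (hn : 0 < n) (hb : 0 < b n) {c t : ℝ}
    (h : t * c * (b n / √(n : ℝ)) ∈ integrableExpSet (fun ω => X 0 ω - m) μ) :
    mgf (fun ω => √(n : ℝ) / b n * (c * ((n : ℝ)⁻¹ * ∑ i ∈ Finset.range n, (X i ω - m)))) μ
      (t * b n ^ 2) =
      Real.exp (n * cgf (fun ω => X 0 ω - m) μ (t * c * (b n / √(n : ℝ)))) := by
  have hind : iIndepFun (fun i ω => X i ω - m) μ :=
    hindep.comp (fun _ x => x - m) fun _ => by fun_prop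
  have hid : ∀ i, IdentDistrib (fun ω => X i ω - m) (fun ω => X 0 ω - m) μ μ := fun i =>
    (hident i).comp (by fun_prop : Measurable fun x : ℝ => x - m)
  have h1 := mgf_sum_of_identDistrib (s := Finset.range n) (j := 0)
    (fun i => (hmeas i).sub_const m) hind
    (fun i _ j _ => (hid i).trans (hid j).symm) (Finset.mem_range.2 hn)
    (t * c * (b n / √(n : ℝ)))
  rw [Finset.card_range] at h1
  rw [Real.exp_nat_mul, exp_cgf h, ← h1]
  simp only [mgf, mul_normalizedSum_eq hn hb]

/-- With `h = a * b n / √n` one has `n * h ^ 2 = a ^ 2 * b n ^ 2`, so an error `o(h ^ 2)` per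
summand becomes `o(b n ^ 2)`. -/
lemma eventually_abs_cgf_sub_le {Y : Ω → ℝ} (hb_pos : ∀ n, 0 < b n)
    (hb_sqrt : Tendsto (fun n : ℕ => b n / √(n : ℝ)) atTop (𝓝 0))
    (h0 : 0 ∈ interior (integrableExpSet Y μ)) (hY : ∫ ω, Y ω ∂μ = 0) (a : ℝ) {ε : ℝ}
    (hε : 0 < ε) :
    ∀ᶠ n : ℕ in atTop,
      |n * cgf Y μ (a * (b n / √(n : ℝ))) - Var[Y; μ] * a ^ 2 / 2 * b n ^ 2| ≤ ε * b n ^ 2 := by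
  have h1 : Tendsto (fun n : ℕ => a * (b n / √(n : ℝ))) atTop (𝓝 0) := by
    simpa using hb_sqrt.const_mul a
  have h2 := (cgf_sub_variance_isLittleO h0 hY).def (c := ε / (a ^ 2 + 1)) (by positivity)
  filter_upwards [h1.eventually h2, eventually_gt_atTop 0] with n hn hn0
  have hnR : (0 : ℝ) < n := by exact_mod_cast hn0
  have hbn := hb_pos n
  have hh : n * (a * (b n / √(n : ℝ))) ^ 2 = a ^ 2 * b n ^ 2 := by
    rw [mul_pow, div_pow, Real.sq_sqrt hnR.le]; field_simp
  rw [Real.norm_eq_abs, Real.norm_eq_abs, abs_of_nonneg (sq_nonneg (a * (b n / √(n : ℝ))))] at hn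
  calc _ = |(n : ℝ) * (cgf Y μ (a * (b n / √(n : ℝ))) -
        Var[Y; μ] / 2 * (a * (b n / √(n : ℝ))) ^ 2)| := by
        congr 1
        linear_combination (Var[Y; μ] / 2) * hh
    _ = (n : ℝ) * |cgf Y μ (a * (b n / √(n : ℝ))) -
        Var[Y; μ] / 2 * (a * (b n / √(n : ℝ))) ^ 2| := by
        rw [abs_mul, abs_of_pos hnR]
    _ ≤ n * (ε / (a ^ 2 + 1) * (a * (b n / √(n : ℝ))) ^ 2) := by gcongr
    _ = ε / (a ^ 2 + 1) * a ^ 2 * b n ^ 2 := by linear_combination (ε / (a ^ 2 + 1)) * hh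
    _ ≤ ε * b n ^ 2 := by
        gcongr
        rw [div_mul_eq_mul_div, div_le_iff₀ (by positivity)]
        gcongr
        linarith

/-- Gaussian asymptotics of the moment generating functions of normalized i.i.d. sums. -/
lemma eventually_mgf_normalizedSum_mem_Icc (hmeas : ∀ i, Measurable (X i))
    (hindep : iIndepFun X μ) (hident : ∀ i, IdentDistrib (X i) (X 0) μ μ)
    (hb_pos : ∀ n, 0 < b n) (hb_sqrt : Tendsto (fun n : ℕ => b n / √(n : ℝ)) atTop (𝓝 0))
    (h0 : 0 ∈ interior (integrableExpSet (fun ω => X 0 ω - m) μ))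
    (hm : ∫ ω, (X 0 ω - m) ∂μ = 0) (c t : ℝ) {ε : ℝ} (hε : 0 < ε) :
    ∀ᶠ n : ℕ in atTop,
      mgf (fun ω => √(n : ℝ) / b n * (c * ((n : ℝ)⁻¹ * ∑ i ∈ Finset.range n, (X i ω - m)))) μ
        (t * b n ^ 2) ∈
      Set.Icc (Real.exp ((c ^ 2 * Var[X 0; μ] * t ^ 2 / 2 - ε) * b n ^ 2))
        (Real.exp ((c ^ 2 * Var[X 0; μ] * t ^ 2 / 2 + ε) * b n ^ 2)) := by
  have hvar : Var[fun ω => X 0 ω - m; μ] = Var[X 0; μ] :=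
    variance_sub_const (hmeas 0).aestronglyMeasurable m
  filter_upwards [eventually_mem_integrableExpSet hb_sqrt h0 (t * c),
    eventually_abs_cgf_sub_le hb_pos hb_sqrt h0 hm (t * c) hε, eventually_gt_atTop 0]
    with n h1 h2 hn
  rw [mgf_normalizedSum hmeas hindep hident hn (hb_pos n) h1]
  rw [hvar] at h2
  have h3 := abs_le.1 h2
  constructor <;> apply Real.exp_le_exp.2 <;> linarith [mul_pow t c 2]

lemma measureReal_exists_lt_le (hident : ∀ i, IdentDistrib (X i) (X 0) μ μ) {t : ℝ}
    (ht : 0 ≤ t) (hexp : Integrable (fun ω => Real.exp (t * X 0 ω)) μ) (n : ℕ) (M : ℝ) :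
    μ.real {ω | ∃ i < n, M < X i ω} ≤ n * (Real.exp (-t * M) * mgf (X 0) μ t) := by
  calc μ.real {ω | ∃ i < n, M < X i ω}
      ≤ μ.real (⋃ i ∈ Finset.range n, {ω | M ≤ X i ω}) := by
        refine measureReal_mono ?_ (measure_ne_top _ _)
        rintro ω ⟨i, hi, hM⟩
        exact Set.mem_biUnion (Finset.mem_coe.2 (Finset.mem_range.2 hi)) hM.le
    _ ≤ ∑ i ∈ Finset.range n, μ.real {ω | M ≤ X i ω} := measureReal_biUnion_finset_le _ _
    _ ≤ ∑ _i ∈ Finset.range n, Real.exp (-t * M) * mgf (X 0) μ t := by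
        refine Finset.sum_le_sum fun i _ => ?_
        rw [← mgf_congr_of_identDistrib (X i) (X 0) (hident i) t]
        exact measure_ge_le_exp_mul_mgf M ht (((hident i).comp
          (by fun_prop : Measurable fun x : ℝ => Real.exp (t * x))).integrable_iff.2 hexp)
    _ = _ := by simp

/-- Exponential tails at level `b √n` are superexponentially small at speed `b ^ 2`. -/
lemma eventually_mul_exp_le (hb_pos : ∀ n, 0 < b n) (hb_top : Tendsto b atTop atTop)
    (hb_sqrt : Tendsto (fun n : ℕ => b n / √(n : ℝ)) atTop (𝓝 0)) {t : ℝ} (ht : 0 < t)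
    (C r : ℝ) :
    ∀ᶠ n : ℕ in atTop, n * (Real.exp (-t * (b n * √(n : ℝ))) * C) ≤ Real.exp (r * b n ^ 2) := by
  -- Half of the exponent `t * b * √n` beats `|r| * b ^ 2`, as `b ≪ √n`; the other half beats `n ≤
  -- exp (2 * √n)` and `C ≤ exp |C|`, as `b → ∞`.
  have h1 : ∀ᶠ n : ℕ in atTop, |r| * (b n / √(n : ℝ)) ≤ t / 2 :=
    (show Tendsto (fun n : ℕ => |r| * (b n / √(n : ℝ))) atTop (𝓝 0) by
      simpa using hb_sqrt.const_mul |r|).eventually_le_const (by positivity)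
  filter_upwards [h1, hb_top.eventually_ge_atTop ((2 + |C|) * 2 / t), eventually_gt_atTop 0]
    with n hr hb hn
  have hnR : (0 : ℝ) < n := by exact_mod_cast hn
  have hsq : 0 < √(n : ℝ) := Real.sqrt_pos.2 hnR
  have hsq2 : √(n : ℝ) * √(n : ℝ) = n := Real.mul_self_sqrt hnR.le
  have hsq1 : 1 ≤ √(n : ℝ) := Real.one_le_sqrt.2 (by exact_mod_cast hn)
  have hbn := hb_pos n
  have hCe : C ≤ Real.exp |C| :=
    (le_abs_self C).trans ((by linarith : |C| ≤ |C| + 1).trans (Real.add_one_le_exp _))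
  have hne : (n : ℝ) ≤ Real.exp (2 * √(n : ℝ)) := by
    have : √(n : ℝ) ≤ Real.exp √(n : ℝ) := by linarith [Real.add_one_le_exp √(n : ℝ)]
    calc (n : ℝ) = √(n : ℝ) * √(n : ℝ) := hsq2.symm
      _ ≤ Real.exp √(n : ℝ) * Real.exp √(n : ℝ) := by gcongr
      _ = _ := by rw [← Real.exp_add]; ring_nf
  have hrb : |r| * b n ^ 2 ≤ t / 2 * (b n * √(n : ℝ)) := by
    calc |r| * b n ^ 2 = |r| * (b n / √(n : ℝ)) * (b n * √(n : ℝ)) := by field_simp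
      _ ≤ _ := by gcongr
  have hrr : -(|r| * b n ^ 2) ≤ r * b n ^ 2 := by
    rw [← neg_mul]; gcongr; exact neg_abs_le r
  rw [div_le_iff₀ ht] at hb
  have hb2 : (2 + |C|) * √(n : ℝ) ≤ t / 2 * (b n * √(n : ℝ)) := by
    calc (2 + |C|) * √(n : ℝ) ≤ (b n * t / 2) * √(n : ℝ) := by gcongr; linarith
      _ = _ := by ring
  have hC1 : |C| ≤ |C| * √(n : ℝ) := le_mul_of_one_le_right (abs_nonneg C) hsq1
  calc n * (Real.exp (-t * (b n * √(n : ℝ))) * C)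
      ≤ n * (Real.exp (-t * (b n * √(n : ℝ))) * Real.exp |C|) := by gcongr
    _ ≤ Real.exp (2 * √(n : ℝ)) * (Real.exp (-t * (b n * √(n : ℝ))) * Real.exp |C|) := by
        gcongr
    _ = Real.exp (2 * √(n : ℝ) + (-t * (b n * √(n : ℝ)) + |C|)) := by
        rw [Real.exp_add, Real.exp_add]
    _ ≤ _ := Real.exp_le_exp.2 (by linarith)

end IIDSums

end UStatMDP

/-! ### Exponential equivalence and the moderate deviations principle -/

/-- The sequence `X 0, X 1, …` plays the role of `X₁, X₂, …`. -/
theorem mainTheorem7 {Ω : Type*} [MeasurableSpace Ω] (μ : Measure Ω) [IsProbabilityMeasure μ]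
    (X : ℕ → Ω → ℝ) (hmeas : ∀ i, Measurable (X i)) (hindep : iIndepFun X μ)
    (hident : ∀ i, IdentDistrib (X i) (X 0) μ μ)
    (hnonneg : ∀ i, ∀ᵐ ω ∂μ, 0 ≤ X i ω) (hmean : 0 < ∫ ω, X 0 ω ∂μ)
    (hexp : ∃ t₀ : ℝ, 0 < t₀ ∧ Integrable (fun ω => Real.exp (t₀ * X 0 ω)) μ)
    (k : ℕ) (hk : 1 ≤ k)
    (b : ℕ → ℝ) (hb_pos : ∀ n, 0 < b n) (hb_top : Tendsto b atTop atTop)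
    (hb_sqrt : Tendsto (fun n : ℕ => b n / √(n : ℝ)) atTop (𝓝 0))
    (m : ℝ) (hm : m = ∫ ω, X 0 ω ∂μ) :
    UStatMDP.ExpEquivalent μ
      (fun n ω => √(n : ℝ) / b n *
        (UStatMDP.uStat (UStatMDP.prodKernel k) n (fun j => X j ω) - m ^ k))
      (fun n ω => √(n : ℝ) / b n * (k * m ^ (k - 1) *
        ((n : ℝ)⁻¹ * ∑ i ∈ Finset.range n, (X i ω - m))))
      (fun n => b n ^ 2) ∧
    (0 < Var[X 0; μ] →
      UStatMDP.SatisfiesMDP μ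
        (fun n ω => √(n : ℝ) / b n *
          (UStatMDP.uStat (UStatMDP.prodKernel k) n (fun j => X j ω) - m ^ k))
        b
        (fun x => ENNReal.ofReal
          (x ^ 2 / (2 * (m ^ (2 * (k - 1)) * (k : ℝ) ^ 2 * Var[X 0; μ]))))) := by
  obtain ⟨t₀, ht₀, hexp⟩ := hexp
  have hm0 : 0 < m := hm ▸ hmean
  have hs : Tendsto (fun n => b n ^ 2) atTop atTop :=
    (tendsto_pow_atTop two_ne_zero).comp hb_top
  have h0 := UStatMDP.zero_mem_interior_integrableExpSet_sub_const (hmeas 0).aemeasurable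
    (hnonneg 0) ht₀ hexp m
  have hint0 : Integrable (X 0) μ := Integrable.of_integral_ne_zero hmean.ne'
  have hcent : ∫ ω, (X 0 ω - m) ∂μ = 0 := by
    rw [integral_sub hint0 (integrable_const m)]; simp [hm]
  have hint : ∀ c t : ℝ, ∀ᶠ n : ℕ in atTop, Integrable (fun ω => Real.exp (t * b n ^ 2 *
      (√(n : ℝ) / b n * (c * ((n : ℝ)⁻¹ * ∑ i ∈ Finset.range n, (X i ω - m)))))) μ := by
    intro c t
    filter_upwards [UStatMDP.eventually_mem_integrableExpSet hb_sqrt h0 (t * c),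
      eventually_gt_atTop 0] with n h1 hn
    exact UStatMDP.integrable_exp_normalizedSum hmeas hindep hident hn (hb_pos n) h1
  have hmgf := fun (c t ε : ℝ) (hε : 0 < ε) => UStatMDP.eventually_mgf_normalizedSum_mem_Icc hmeas hindep hident
    hb_pos hb_sqrt h0 hcent c t hε
  have hup : ∀ (c v : ℝ), c ^ 2 * Var[X 0; μ] ≤ v → ∀ t : ℝ, ∀ r > v * t ^ 2 / 2,
      ∀ᶠ n : ℕ in atTop,
        mgf (fun ω => √(n : ℝ) / b n * (c * ((n : ℝ)⁻¹ * ∑ i ∈ Finset.range n, (X i ω - m)))) μ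
          (t * b n ^ 2) ≤ Real.exp (r * b n ^ 2) := by
    intro c v hv t r hr
    have hv' : c ^ 2 * Var[X 0; μ] * t ^ 2 / 2 ≤ v * t ^ 2 / 2 := by gcongr
    filter_upwards [hmgf c t (r - c ^ 2 * Var[X 0; μ] * t ^ 2 / 2) (by linarith)] with n hn
    simpa using hn.2
  have hclose : ∀ ε > 0, ∀ r : ℝ, ∀ᶠ n : ℕ in atTop, μ.real {ω | ε < |√(n : ℝ) / b n *
      (UStatMDP.uStat (UStatMDP.prodKernel k) n (fun j => X j ω) - m ^ k) -
      √(n : ℝ) / b n * (k * m ^ (k - 1) * ((n : ℝ)⁻¹ * ∑ i ∈ Finset.range n, (X i ω - m)))|} ≤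
      Real.exp (r * b n ^ 2) := by
    intro ε hε r
    have hvar0 : 0 ≤ Var[X 0; μ] := variance_nonneg _ _
    -- The variance may vanish in this part, hence the proxy `Var[X 0; μ] + 1`; `L` is chosen so
    -- large that the tail of the normalized sum beats the prescribed rate.
    obtain ⟨L, hL, hLr⟩ : ∃ L > 0, -(L ^ 2 / (2 * (Var[X 0; μ] + 1))) < r - 1 := by
      have h1 : Tendsto (fun L : ℝ => L ^ 2 / (2 * (Var[X 0; μ] + 1))) atTop atTop :=
        (tendsto_pow_atTop two_ne_zero).atTop_div_const (by positivity)
      obtain ⟨L, hL1, hL2⟩ :=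
        ((h1.eventually_gt_atTop (-(r - 1))).and (eventually_gt_atTop 0)).exists
      exact ⟨L, hL2, by linarith⟩
    obtain ⟨δ, hδ, hdet⟩ := UStatMDP.exists_eventually_abs_uStat_sub_le (k := k) hb_pos hb_top
      hb_sqrt hm0 hε hL
    have htail := UStatMDP.eventually_measureReal_le_abs_of_mgf hs
      (v := Var[X 0; μ] + 1) (by positivity) (hint 1) (hup 1 _ (by linarith)) hL hLr
    filter_upwards [hdet, htail, UStatMDP.eventually_two_mul_exp_le hs (sub_one_lt r),
      UStatMDP.eventually_mul_exp_le hb_pos hb_top hb_sqrt (mul_pos ht₀ hδ) (mgf (X 0) μ t₀)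
        (r - 1)] with n hn h1 h2 h3
    have hmax := UStatMDP.measureReal_exists_lt_le hident ht₀.le hexp n (δ * (b n * √(n : ℝ)))
    rw [show -t₀ * (δ * (b n * √(n : ℝ))) = -(t₀ * δ) * (b n * √(n : ℝ)) by ring] at hmax
    refine le_trans ?_ ((add_le_add (hmax.trans h3) h1).trans (by linarith))
    refine le_trans ?_ (measureReal_union_le _ _)
    -- Nonnegativity holds only almost surely, so the inclusion into the two exceptional events is
    -- an a.e. one.
    refine ENNReal.toReal_mono (measure_ne_top _ _) (measure_mono_ae ?_)
    filter_upwards [ae_all_iff.2 hnonneg] with ω hω hεω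
    by_contra hcon
    change ¬ (ω ∈ {ω | _} ∨ ω ∈ {ω | _}) at hcon
    simp only [Set.mem_ofPred_eq, not_or, not_exists, not_and, not_lt, not_le, one_mul] at hcon
    have hsum := Fin.sum_univ_eq_sum_range (fun i => X i ω - m) n
    have := hn (fun j => X j ω) (fun i => hω i) (fun i => hcon.1 i i.2)
      (by rw [hsum]; exact hcon.2.le)
    rw [hsum] at this
    exact absurd hεω (not_lt.2 this)
  refine ⟨UStatMDP.expEquivalent_of_forall_eventually_le hs hclose, fun hvar => ?_⟩
  have hveq : (k * m ^ (k - 1)) ^ 2 * Var[X 0; μ] =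
      m ^ (2 * (k - 1)) * (k : ℝ) ^ 2 * Var[X 0; μ] := by ring
  have hk0 : (0 : ℝ) < k := by exact_mod_cast hk
  set c : ℝ := k * m ^ (k - 1) with hc
  have hv : 0 < m ^ (2 * (k - 1)) * (k : ℝ) ^ 2 * Var[X 0; μ] := by positivity
  set v := m ^ (2 * (k - 1)) * (k : ℝ) ^ 2 * Var[X 0; μ]
  have hlow : ∀ t : ℝ, ∀ r < v * t ^ 2 / 2, ∀ᶠ n : ℕ in atTop, Real.exp (r * b n ^ 2) ≤
      mgf (fun ω => √(n : ℝ) / b n * (c * ((n : ℝ)⁻¹ * ∑ i ∈ Finset.range n, (X i ω - m)))) μ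
        (t * b n ^ 2) := by
    intro t r hr
    rw [← hveq] at hr
    filter_upwards [hmgf c t (c ^ 2 * Var[X 0; μ] * t ^ 2 / 2 - r) (by linarith)] with n hn
    simpa using hn.1
  refine ⟨hb_pos, hb_top, hb_sqrt, UStatMDP.satisfiesLDP_gaussian hs hv ?_ ?_⟩
  · intro x δ hδ r hr
    refine UStatMDP.eventually_le_measureReal_of_expClose hs hclose ?_ x hδ hr
    intro x δ hδ r hr
    exact UStatMDP.eventually_le_measureReal_of_mgf (fun n => by fun_prop) hs hv (hint c)
      (hup c v hveq.le) hlow x hδ hr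
  · intro x hx r hr
    refine UStatMDP.eventually_measureReal_le_abs_of_expClose hs hclose ?_ hx hr
    intro x hx r hr
    exact UStatMDP.eventually_measureReal_le_abs_of_mgf hs hv (hint c) (hup c v hveq.le) hx hr
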